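/- Let $F$ be a field of characteristic $2$ and let $A$ be a (finite-dimensional) central simple algebra over $F$ of even degree $n$ (so $\dim_F A=n^2$). For $a\in A$ let $\mathrm{Prd}_{A,a}(x)=\det(xI_n-\phi(1\otimes a))=x^n-t_1(a)x^{n-1}+t_2(a)x^{n-2}-\cdots+(-1)^nt_n(a)\in F[x]$ be the reduced polynomial of $a$, where $\phi:E\otimes_F A\to M_n(E)$ is an isomorphism of $E$-algebras for a splitting field $E\supseteq F$ of $A$ (the polynomial does not depend on $E$ and $\phi$), and let $T_{A/F}=(A,t_2)$ be the second trace form, a quadratic form on the $F$-vector space $A$. For $a,b\in F$ let $[a,b]$ be the binary quadratic form $ax^2+xy+by^2$, and let $\mathbb{H}=[0,0]$ be the hyperbolic plane. Two quadratic forms $q,q'$ over $F$ are called Witt equivalent if $q\perp m\mathbb{H}\cong q'\perp m'\mathbb{H}$ for some integers $m,m'\ge 0$. If $T_{A/F}$ is Witt equivalent neither to $[1,1]$ nor to $\mathbb{H}$, then there are an odd positive integer $k$ and a division algebra $D$ over $F$ such that $A\cong M_k(D)$ as $F$-algebras. -/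

import Mathlib

open scoped TensorProduct Polynomial

universe u v w w'

noncomputable section

/-! ### Quadratic forms and Witt equivalence -/

/-- The binary quadratic form `[a, b]`, that is `a x² + x y + b y²`. -/
def binaryForm {F : Type u} [Field F] (a b : F) : QuadraticForm F (Fin 2 → F) :=
  a • QuadraticMap.linMulLin (LinearMap.proj 0) (LinearMap.proj 0) +
    QuadraticMap.linMulLin (LinearMap.proj 0) (LinearMap.proj 1) +
    b • QuadraticMap.linMulLin (LinearMap.proj 1) (LinearMap.proj 1)

/-- The hyperbolic plane `ℍ = [0, 0]`. -/
def hyperbolicPlane (F : Type u) [Field F] : QuadraticForm F (Fin 2 → F) :=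
  binaryForm 0 0

/-- The hyperbolic form `m ℍ`: the orthogonal sum of `m` hyperbolic planes. -/
def hyperbolicForm (F : Type u) [Field F] (m : ℕ) : QuadraticForm F (Fin m → Fin 2 → F) :=
  QuadraticMap.pi fun _ => hyperbolicPlane F

/-- Witt equivalence of (nonsingular) quadratic forms: `Q₁ ⊥ m ℍ` and `Q₂ ⊥ m' ℍ` are isometric
for some `m` and `m'`. -/
def WittEquivalent {F : Type u} [Field F] {V : Type w} {W : Type w'}
    [AddCommGroup V] [Module F V] [AddCommGroup W] [Module F W]
    (Q₁ : QuadraticForm F V) (Q₂ : QuadraticForm F W) : Prop :=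
  ∃ m m' : ℕ, QuadraticMap.Equivalent
    (QuadraticMap.prod Q₁ (hyperbolicForm F m)) (QuadraticMap.prod Q₂ (hyperbolicForm F m'))

/-! ### The second coefficient of the characteristic polynomial of a matrix is quadratic -/

theorem exists_linear_of_isHomogeneous_one {E : Type u} [Field E] {σ : Type w}
    (p : MvPolynomial σ E) (hp : p ∈ MvPolynomial.homogeneousSubmodule σ E 1) :
    ∃ l : (σ → E) →ₗ[E] E, ∀ x, l x = MvPolynomial.eval x p := by
  rw [MvPolynomial.homogeneousSubmodule_one_eq_span_X] at hp
  induction hp using Submodule.span_induction with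
  | mem p h =>
    obtain ⟨i, rfl⟩ := h
    exact ⟨LinearMap.proj i, fun x => by simp⟩
  | zero => exact ⟨0, fun x => by simp⟩
  | add p q _ _ hp hq =>
    obtain ⟨l, hl⟩ := hp
    obtain ⟨l', hl'⟩ := hq
    exact ⟨l + l', fun x => by simp [hl, hl']⟩
  | smul c p _ hp =>
    obtain ⟨l, hl⟩ := hp
    exact ⟨c • l, fun x => by simp [hl]⟩

theorem exists_quadratic_of_isHomogeneous_two {E : Type u} [Field E] {σ : Type w}
    (p : MvPolynomial σ E) (hp : p.IsHomogeneous 2) :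
    ∃ Q : QuadraticForm E (σ → E), ∀ x, Q x = MvPolynomial.eval x p := by
  have hp' : p ∈ MvPolynomial.homogeneousSubmodule σ E 1 *
      MvPolynomial.homogeneousSubmodule σ E 1 := by
    rw [← pow_two, MvPolynomial.homogeneousSubmodule_one_pow]
    exact hp
  clear hp
  induction hp' using Submodule.mul_induction_on' with
  | mem_mul_mem p hp q hq =>
    obtain ⟨l, hl⟩ := exists_linear_of_isHomogeneous_one p hp
    obtain ⟨l', hl'⟩ := exists_linear_of_isHomogeneous_one q hq
    exact ⟨QuadraticMap.linMulLin l l', fun x => by simp [hl, hl']⟩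
  | add p _ q _ hp hq =>
    obtain ⟨Q, hQ⟩ := hp
    obtain ⟨Q', hQ'⟩ := hq
    exact ⟨Q + Q', fun x => by simp [hQ, hQ']⟩

theorem exists_quadratic_charpoly_coeff (E : Type u) [Field E] (n : ℕ) (hn : 2 ≤ n) :
    ∃ Q : QuadraticForm E (Matrix (Fin n) (Fin n) E), ∀ M, Q M = M.charpoly.coeff (n - 2) := by
  obtain ⟨Q, hQ⟩ := exists_quadratic_of_isHomogeneous_two
    ((Matrix.charpoly.univ E (Fin n)).coeff (n - 2))
    (Matrix.charpoly.univ_coeff_isHomogeneous E (Fin n) (n - 2) 2 (by simp; omega))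
  let f : Matrix (Fin n) (Fin n) E →ₗ[E] (Fin n × Fin n → E) :=
    LinearMap.pi fun ij => Matrix.entryLinearMap E E ij.1 ij.2
  refine ⟨Q.comp f, fun M => ?_⟩
  have h := Matrix.charpoly.univ_coeff_eval₂Hom (Fin n) (RingHom.id E)
    (fun ij : Fin n × Fin n => M ij.1 ij.2) (n - 2)
  rw [QuadraticMap.comp_apply, hQ]
  exact h

/-! ### Central simple algebras: degree, reduced polynomial, second trace form -/

/-- The degree of a central simple algebra `A` over `F`: the integer `n` with `dim_F A = n²`
(the dimension of a central simple algebra is always a perfect square). -/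
def csaDegree (F : Type u) (A : Type v) [Field F] [Ring A] [Algebra F A] : ℕ :=
  Nat.sqrt (Module.finrank F A)

/-- `P : A → F[x]` is the reduced polynomial: for some splitting field `E` of `A` with splitting
representation `φ : E ⊗ A ≃ M_n(E)`, where `n` is the degree of `A`, the polynomial `P a` is
`det (x I_n - φ (1 ⊗ a))` for every `a`. -/
def IsReducedPolynomial (F : Type u) (A : Type v) [Field F] [Ring A] [Algebra F A]
    (P : A → F[X]) : Prop :=
  ∃ (E : Type u) (_ : Field E) (_ : Algebra F E)
    (φ : (E ⊗[F] A) ≃ₐ[E] Matrix (Fin (csaDegree F A)) (Fin (csaDegree F A)) E),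
    ∀ a : A, (P a).map (algebraMap F E) = (φ (1 ⊗ₜ[F] a)).charpoly

open Classical in
/-- The reduced polynomial `Prd_{A,a}(x)`. It exists and is unique for every central simple algebra
(its coefficients lie in `F` and do not depend on the choice of `E` and `φ`); the value `0` in the
other branch is only used for algebras that are not central simple. -/
def reducedPolynomial (F : Type u) (A : Type v) [Field F] [Ring A] [Algebra F A] : A → F[X] :=
  if h : ∃ P : A → F[X], IsReducedPolynomial F A P then h.choose else 0

/-- The coefficients `t_i(a)` in
`Prd_{A,a}(x) = x^n - t_1(a) x^(n-1) + t_2(a) x^(n-2) + ⋯ + (-1)^n t_n(a)`. -/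
def reducedCoeff (F : Type u) (A : Type v) [Field F] [Ring A] [Algebra F A] (i : ℕ) (a : A) : F :=
  if i ≤ csaDegree F A then (-1) ^ i * (reducedPolynomial F A a).coeff (csaDegree F A - i) else 0

/-- In every case `t_2` is the pull-back of a quadratic form along an `F`-linear map to an
`E`-vector space, for some field extension `E` of `F`. -/
theorem exists_quadratic_reducedCoeff_two (F : Type u) (A : Type v) [Field F] [Ring A]
    [Algebra F A] :
    ∃ (E : Type u) (_ : Field E) (_ : Algebra F E) (n : ℕ)
      (Q : QuadraticForm E (Matrix (Fin n) (Fin n) E))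
      (f : A →ₗ[F] Matrix (Fin n) (Fin n) E),
      ∀ a, algebraMap F E (reducedCoeff F A 2 a) = Q (f a) := by
  by_cases h : (∃ P : A → F[X], IsReducedPolynomial F A P) ∧ 2 ≤ csaDegree F A
  · obtain ⟨E, iE, iA, φ, hφ⟩ := h.1.choose_spec
    obtain ⟨Q, hQ⟩ := exists_quadratic_charpoly_coeff E (csaDegree F A) h.2
    refine ⟨E, iE, iA, csaDegree F A, Q,
      (φ.toLinearMap.restrictScalars F) ∘ₗ
        (Algebra.TensorProduct.includeRight (R := F) (A := E) (B := A)).toLinearMap, fun a => ?_⟩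
    have h1 : reducedPolynomial F A a = h.1.choose a := by
      rw [reducedPolynomial, dif_pos h.1]
    rw [reducedCoeff, if_pos h.2, h1, hQ]
    have h2 := congrArg (fun p => p.coeff (csaDegree F A - 2)) (hφ a)
    simp only [Polynomial.coeff_map] at h2
    simpa using h2
  · refine ⟨F, inferInstance, inferInstance, 0, 0, 0, fun a => ?_⟩
    rw [not_and_or] at h
    rcases h with h | h
    · simp [reducedCoeff, reducedPolynomial, dif_neg h]
    · simp [reducedCoeff, if_neg h]

/-- The second trace form `T_{A/F} = (A, t_2)` of a central simple algebra of even degree over a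
field of characteristic two. -/
def secondTraceForm (F : Type u) (A : Type v) [Field F] [Ring A] [Algebra F A] :
    QuadraticForm F A :=
  QuadraticMap.ofPolar (reducedCoeff F A 2)
    (fun c a => by
      obtain ⟨E, _, _, n, Q, f, h⟩ := exists_quadratic_reducedCoeff_two F A
      apply (algebraMap F E).injective
      have h3 : f (c • a) = algebraMap F E c • f a := by rw [map_smul, algebraMap_smul]
      rw [h, h3, QuadraticMap.map_smul, smul_eq_mul, smul_eq_mul, map_mul, map_mul, h])
    (fun a b c => by
      obtain ⟨E, _, _, n, Q, f, h⟩ := exists_quadratic_reducedCoeff_two F A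
      apply (algebraMap F E).injective
      have h4 := QuadraticMap.polar_add_left Q (f a) (f b) (f c)
      simpa only [QuadraticMap.polar, map_sub, map_add, h] using h4)
    (fun r a b => by
      obtain ⟨E, _, _, n, Q, f, h⟩ := exists_quadratic_reducedCoeff_two F A
      apply (algebraMap F E).injective
      have h3 : f (r • a) = algebraMap F E r • f a := by rw [map_smul, algebraMap_smul]
      have h4 := QuadraticMap.polar_smul_left Q (algebraMap F E r) (f a) (f b)
      simp only [smul_eq_mul] at h4
      simpa only [QuadraticMap.polar, map_sub, map_add, map_mul, smul_eq_mul, h, h3] using h4)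

end

/-! By Wedderburn `A ≅ M_k(D)`, so it suffices to treat even `k`, where `A ≅ M_2(B)` with `B =
M_{k/2}(D)` central simple. Let `t` be the reduced trace and `Q` the second trace form of `B`. On a
block matrix with entries `x, y; z, w` the form `T` of `A` is `Q(x) + Q(w) + t(x)t(w) - t(yz)`. Put
`s = x + w`. The polar identity `Q(x + y) = Q(x) + Q(y) + t(x)t(y) - t(xy)` and characteristic 2
turn this into `Q(s) + t(xs) + t(x)² + t(yz)`.

Since `t` is nondegenerate, `t(yz)` is hyperbolic. Expand `s` in a basis of `B` containing 1, and
let `β` be its coordinate at 1 and `α = t(x)`. The remaining terms are `α² + αβ + Q(1)β²` plus, for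
every other basis vector, the coordinate of `s` times a linear form. Hence `T ≅ [1, Q(1)] ⊥ mℍ`
(`exists_equivalent_of_blocks`). Finally `Q(1)` is a binomial coefficient mod 2, and `[1, 0] ≅ ℍ`,
so `T` is Witt equivalent to `[1, 1]` or `ℍ`.

The rest of the work identifies the reduced polynomial with the characteristic polynomial in any
representation of the right degree (`map_reducedPolynomial`). -/

/-! ### Scalar extension of central simple algebras -/

namespace CentralSimple

section Tensor

variable {F : Type*} [Field F] {E : Type*} [Field E] [Algebra F E] {A : Type*} [Ring A] [Algebra F A]
  {ι : Type*}

open Classical in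
/-- The coordinates of an element of `E ⊗ A` with respect to a basis of `E`. -/
noncomputable def coords (b : Module.Basis ι F E) : (E ⊗[F] A) ≃ₗ[F] (ι →₀ A) :=
  TensorProduct.equivFinsuppOfBasisLeft b

theorem coords_tmul_mul (b : Module.Basis ι F E) (a : A) (z : E ⊗[F] A) (i : ι) :
    coords b ((1 ⊗ₜ[F] a) * z) i = a * coords b z i := by
  induction z using TensorProduct.induction_on with
  | zero => simp
  | tmul x y => simp [coords]
  | add x y hx hy => simp [mul_add, hx, hy]

theorem coords_mul_tmul (b : Module.Basis ι F E) (a : A) (z : E ⊗[F] A) (i : ι) :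
    coords b (z * (1 ⊗ₜ[F] a)) i = coords b z i * a := by
  induction z using TensorProduct.induction_on with
  | zero => simp
  | tmul x y => simp [coords]
  | add x y hx hy => simp [add_mul, hx, hy]

/-- Commuting with `1 ⊗ A` can be tested coordinatewise, so every coordinate is central in `A`,
hence a scalar that moves to the left factor. -/
theorem exists_tmul_one_of_commute [Algebra.IsCentral F A] (b : Module.Basis ι F E) (z : E ⊗[F] A)
    (hz : ∀ a : A, (1 ⊗ₜ[F] a) * z = z * (1 ⊗ₜ[F] a)) : ∃ e : E, z = e ⊗ₜ[F] (1 : A) := by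
  classical
  have h1 : ∀ i, ∃ c : F, algebraMap F A c = coords b z i := fun i => by
    have : coords b z i ∈ Subalgebra.center F A := by
      rw [Subalgebra.mem_center_iff]
      intro a
      rw [← coords_tmul_mul, ← coords_mul_tmul, hz]
    exact Algebra.IsCentral.out this
  choose c hc using h1
  refine ⟨∑ i ∈ (coords b z).support, c i • b i, ?_⟩
  have h2 : z = (coords b).symm (coords b z) := by simp
  conv_lhs => rw [h2]
  rw [coords, TensorProduct.equivFinsuppOfBasisLeft_symm_apply, Finsupp.sum,
    TensorProduct.sum_tmul]
  refine Finset.sum_congr rfl fun i _ => ?_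
  rw [TensorProduct.smul_tmul, ← Algebra.algebraMap_eq_smul_one, hc]
  rfl

end Tensor

variable (F : Type*) [Field F] (E : Type*) [Field E] [Algebra F E] (A : Type*) [Ring A] [Algebra F A]

/-- Shortest-element argument: a nonzero element of `I` with minimal support can be normalised to
have a coefficient 1. Its commutators with `1 ⊗ a` then have smaller support, so they vanish, and
the element is a unit `e ⊗ 1`. -/
instance isSimpleRing_tensor [Algebra.IsCentral F A] [IsSimpleRing A] :
    IsSimpleRing (E ⊗[F] A) := by
  classical
  have : Nontrivial (E ⊗[F] A) :=
    (Algebra.TensorProduct.includeRight_injective (R := F) (A := E) (B := A)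
      (algebraMap F E).injective).nontrivial
  refine IsSimpleRing.of_eq_bot_or_eq_top fun I => or_iff_not_imp_left.2 fun hI => ?_
  let b := Module.Basis.ofVectorSpace F E
  have hex : ∃ n, ∃ z ∈ I, z ≠ 0 ∧ (coords b z).support.card = n := by
    obtain ⟨z, hz, hz0⟩ := SetLike.exists_of_lt (bot_lt_iff_ne_bot.mpr hI)
    exact ⟨_, z, hz, hz0, rfl⟩
  obtain ⟨z, hz, hz0, hzn⟩ := Nat.find_spec hex
  have hmin : ∀ w ∈ I, (coords b w).support ⊂ (coords b z).support → w = 0 := by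
    intro w hw hlt
    by_contra hw0
    exact Nat.find_min hex (hzn ▸ Finset.card_lt_card hlt) ⟨w, hw, hw0, rfl⟩
  obtain ⟨j, hj⟩ : (coords b z).support.Nonempty := by
    rw [Finsupp.support_nonempty_iff]
    simpa using hz0
  -- The `j`-th coefficients of elements of `I` supported inside the support of `z`; simplicity of
  -- `A` puts 1 among them.
  let J : TwoSidedIdeal A := TwoSidedIdeal.mk'
    {x | ∃ w ∈ I, (coords b w).support ⊆ (coords b z).support ∧ coords b w j = x}
    ⟨0, I.zero_mem, by simp, by simp⟩
    (by
      rintro _ _ ⟨w, hw, hs, rfl⟩ ⟨w', hw', hs', rfl⟩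
      refine ⟨w + w', I.add_mem hw hw', ?_, by simp⟩
      rw [map_add]
      exact Finsupp.support_add.trans (Finset.union_subset hs hs'))
    (by
      rintro _ ⟨w, hw, hs, rfl⟩
      exact ⟨-w, I.neg_mem hw, by simpa using hs, by simp⟩)
    (by
      rintro x _ ⟨w, hw, hs, rfl⟩
      refine ⟨(1 ⊗ₜ x) * w, I.mul_mem_left _ _ hw, fun i hi => hs ?_, coords_tmul_mul b _ _ _⟩
      rw [Finsupp.mem_support_iff, coords_tmul_mul] at hi
      exact Finsupp.mem_support_iff.2 (right_ne_zero_of_mul hi))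
    (by
      rintro _ x ⟨w, hw, hs, rfl⟩
      refine ⟨w * (1 ⊗ₜ x), I.mul_mem_right _ _ hw, fun i hi => hs ?_, coords_mul_tmul b _ _ _⟩
      rw [Finsupp.mem_support_iff, coords_mul_tmul] at hi
      exact Finsupp.mem_support_iff.2 (left_ne_zero_of_mul hi))
  have hJ : ∀ x, x ∈ J ↔ ∃ w ∈ I, (coords b w).support ⊆ (coords b z).support ∧
      coords b w j = x := fun x => TwoSidedIdeal.mem_mk' ..
  obtain ⟨w, hw, hs, hwj⟩ := (hJ 1).1 (IsSimpleRing.one_mem_of_ne_zero_mem J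
    (Finsupp.mem_support_iff.1 hj) ((hJ _).2 ⟨z, hz, subset_rfl, rfl⟩))
  obtain ⟨e, rfl⟩ := exists_tmul_one_of_commute b w fun a => by
    rw [← sub_eq_zero]
    refine hmin _ (I.sub_mem (I.mul_mem_left _ _ hw) (I.mul_mem_right _ _ hw)) ?_
    rw [Finset.ssubset_iff_of_subset]
    · refine ⟨j, hj, ?_⟩
      rw [Finsupp.notMem_support_iff, map_sub, Finsupp.sub_apply, coords_tmul_mul, coords_mul_tmul,
        hwj]
      simp
    · intro i hi
      refine hs (Finsupp.mem_support_iff.2 fun h0 => Finsupp.mem_support_iff.1 hi ?_)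
      rw [map_sub, Finsupp.sub_apply, coords_tmul_mul, coords_mul_tmul, h0]
      simp
  have he : e ≠ 0 := by
    rintro rfl
    simp at hwj
  rw [← I.one_mem_iff]
  have := I.mul_mem_left (e⁻¹ ⊗ₜ[F] (1 : A)) _ hw
  rwa [Algebra.TensorProduct.tmul_mul_tmul, inv_mul_cancel₀ he, one_mul,
    ← Algebra.TensorProduct.one_def] at this

instance isCentral_tensor [Algebra.IsCentral F A] : Algebra.IsCentral E (E ⊗[F] A) where
  out z hz := by
    rw [Subalgebra.mem_center_iff] at hz
    obtain ⟨e, rfl⟩ := exists_tmul_one_of_commute (Module.Basis.ofVectorSpace F E) z fun a => hz _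
    exact ⟨e, rfl⟩

theorem isCentral_of_matrix {ι : Type*} [Fintype ι] [DecidableEq ι] [Nonempty ι]
    [Algebra.IsCentral F (Matrix ι ι A)] : Algebra.IsCentral F A where
  out z hz := by
    have h1 : Matrix.scalarAlgHom ι F z ∈ Subalgebra.center F (Matrix ι ι A) := by
      rw [Matrix.subalgebraCenter_eq_scalarAlgHom_map]
      exact ⟨z, hz, rfl⟩
    obtain ⟨c, hc⟩ := Algebra.mem_bot.1 (Algebra.IsCentral.out h1)
    refine ⟨c, ?_⟩
    obtain ⟨i⟩ := ‹Nonempty ι›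
    have := congrFun (congrFun hc i) i
    simpa [Matrix.algebraMap_matrix_apply] using this

/-- By Jacobson–Noether, a noncommutative or larger `D` would contain a noncentral separable
element, whose minimal polynomial must be linear over `F`. So `D = F`. -/
theorem exists_algEquiv_matrix_of_isSepClosed [IsSepClosed F] [Algebra.IsCentral F A]
    [IsSimpleRing A] [FiniteDimensional F A] :
    ∃ n : ℕ, Nonempty (A ≃ₐ[F] Matrix (Fin n) (Fin n) F) := by
  have := IsArtinianRing.of_finite F A
  obtain ⟨n, hn, D, _, _, _, ⟨e⟩⟩ := IsSimpleRing.exists_algEquiv_matrix_divisionRing_finite F A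
  have := Algebra.IsCentral.of_algEquiv F _ _ e
  have hD : Algebra.IsCentral F D := isCentral_of_matrix F D (ι := Fin n)
  have hbot : (⊥ : Subalgebra F D) = ⊤ := by
    by_contra hne
    obtain ⟨x, hx, hsep⟩ := JacobsonNoether.exists_separable_and_not_isCentral' hne
    have hi : IsIntegral F x := Algebra.IsIntegral.isIntegral x
    have h1 := IsSepClosed.degree_eq_one_of_irreducible F (minpoly.irreducible hi) hsep
    exact hx (Algebra.mem_bot.2 (minpoly.mem_range_of_degree_eq_one F x h1))
  have hbij : Function.Bijective (Algebra.ofId F D) :=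
    ⟨(algebraMap F D).injective, fun x => Algebra.mem_bot.1 (hbot ▸ Algebra.mem_top : x ∈ _)⟩
  exact ⟨n, ⟨e.trans (AlgEquiv.mapMatrix (AlgEquiv.ofBijective _ hbij).symm)⟩⟩

/-- A central simple algebra of finite dimension is split by a separably closed field. -/
theorem exists_splitting [IsSepClosed E] [Algebra.IsCentral F A] [IsSimpleRing A]
    [FiniteDimensional F A] :
    ∃ n : ℕ, Module.finrank F A = n ^ 2 ∧
      Nonempty ((E ⊗[F] A) ≃ₐ[E] Matrix (Fin n) (Fin n) E) := by
  obtain ⟨n, ⟨e⟩⟩ := exists_algEquiv_matrix_of_isSepClosed E (E ⊗[F] A)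
  refine ⟨n, ?_, ⟨e⟩⟩
  rw [← Module.finrank_baseChange (R := E), e.toLinearEquiv.finrank_eq, Module.finrank_matrix]
  simp [sq]

end CentralSimple

/-! ### The reduced polynomial -/

theorem Matrix.charpoly_blockDiagonal_const {R ι κ : Type*} [CommRing R] [Fintype ι]
    [DecidableEq ι] [Fintype κ] [DecidableEq κ] (X : Matrix ι ι R) :
    (Matrix.blockDiagonal fun _ : κ => X).charpoly = X.charpoly ^ Fintype.card κ := by
  have : (Matrix.blockDiagonal fun _ : κ => X).charmatrix =
      Matrix.blockDiagonal fun _ : κ => X.charmatrix := by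
    ext ⟨i, k⟩ ⟨j, l⟩
    by_cases hkl : k = l <;> by_cases hij : i = j <;>
      simp [Matrix.blockDiagonal_apply, hkl, hij]
  rw [Matrix.charpoly, this, Matrix.det_blockDiagonal]
  simp [Matrix.charpoly]

/-- Left multiplication by `X` acts on each column separately. -/
theorem Matrix.charpoly_mulLeft {E ι : Type*} [Field E] [Fintype ι] [DecidableEq ι]
    (X : Matrix ι ι E) :
    (LinearMap.mulLeft E X).charpoly = X.charpoly ^ Fintype.card ι := by
  rw [← LinearMap.charpoly_toMatrix _ (Matrix.stdBasis E ι ι),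
    ← Matrix.charpoly_blockDiagonal_const]
  congr 1
  ext ⟨i, j⟩ ⟨k, l⟩
  rw [LinearMap.toMatrix_apply, Matrix.stdBasis_eq_single, LinearMap.mulLeft_apply,
    Matrix.blockDiagonal_apply]
  have h : ∀ M : Matrix ι ι E, (Matrix.stdBasis E ι ι).repr M (i, j) = M i j := fun M => rfl
  rw [h]
  by_cases hjl : j = l
  · subst hjl
    simp
  · simp [hjl]

theorem Polynomial.Monic.pow_left_injective {K : Type*} [Field K] {p q : K[X]} (hp : p.Monic)
    (hq : q.Monic) {n : ℕ} (hn : n ≠ 0) (h : p ^ n = q ^ n) : p = q :=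
  Polynomial.eq_of_monic_of_associated hp hq (associated_of_dvd_dvd
    ((IsIntegrallyClosed.pow_dvd_pow_iff hn).1 h.dvd)
    ((IsIntegrallyClosed.pow_dvd_pow_iff hn).1 h.symm.dvd))

namespace CentralSimple

theorem card_ne_zero {F A ι : Type*} [Field F] [Ring A] [Algebra F A] [IsSimpleRing A]
    [FiniteDimensional F A] [Fintype ι] (hι : Module.finrank F A = Fintype.card ι ^ 2) :
    Fintype.card ι ≠ 0 := by
  intro h
  rw [h] at hι
  exact Module.finrank_pos.ne' hι

/-- The algebra map `E ⊗ A → M_ι(E)` defined by a representation of `A`. -/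
noncomputable def extendRep {F E A ι : Type*} [Field F] [Field E] [Algebra F E] [Ring A]
    [Algebra F A] [Fintype ι] [DecidableEq ι] (ρ : A →ₐ[F] Matrix ι ι E) :
    (E ⊗[F] A) →ₐ[E] Matrix ι ι E :=
  Algebra.TensorProduct.lift (Algebra.ofId E _) ρ fun x y =>
    show Commute (Algebra.ofId E (Matrix ι ι E) x) (ρ y) from Algebra.commutes x (ρ y)

theorem extendRep_one_tmul {F E A ι : Type*} [Field F] [Field E] [Algebra F E] [Ring A]
    [Algebra F A] [Fintype ι] [DecidableEq ι] (ρ : A →ₐ[F] Matrix ι ι E) (a : A) :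
    extendRep ρ (1 ⊗ₜ a) = ρ a :=
  (Algebra.TensorProduct.lift_tmul _ _ _ _ _).trans (by rw [map_one, one_mul])

section

variable {F E A ι : Type*} [Field F] [Field E] [Algebra F E] [Ring A]
    [Algebra F A] [Algebra.IsCentral F A] [IsSimpleRing A] [FiniteDimensional F A]
    [Fintype ι] [DecidableEq ι]

theorem extendRep_bijective (ρ : A →ₐ[F] Matrix ι ι E)
    (hι : Module.finrank F A = Fintype.card ι ^ 2) : Function.Bijective (extendRep ρ) := by
  have : Nonempty ι := Fintype.card_pos_iff.1 (Nat.pos_of_ne_zero (card_ne_zero hι))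
  have hinj : Function.Injective (extendRep ρ).toLinearMap := (extendRep ρ).toRingHom.injective
  refine ⟨hinj, (LinearMap.injective_iff_surjective_of_finrank_eq_finrank ?_).1 hinj⟩
  rw [Module.finrank_baseChange, hι, Module.finrank_matrix]
  simp [sq]

/-- The right-hand side comes from `A` alone. As monic polynomials over a field have unique monic
roots of a given order, this gives both descent to `F` and independence of the representation. -/
theorem charpoly_pow_card (ρ : A →ₐ[F] Matrix ι ι E)
    (hι : Module.finrank F A = Fintype.card ι ^ 2) (a : A) :
    (ρ a).charpoly ^ Fintype.card ι =
      (LinearMap.mulLeft F a).charpoly.map (algebraMap F E) := by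
  let e := (AlgEquiv.ofBijective (extendRep ρ) (extendRep_bijective ρ hι)).toLinearEquiv
  rw [← Matrix.charpoly_mulLeft, ← LinearMap.charpoly_baseChange, ← LinearEquiv.charpoly_conj e]
  congr 1
  refine LinearMap.ext fun y => ?_
  obtain ⟨z, rfl⟩ := e.surjective y
  rw [LinearEquiv.conj_apply_apply, LinearEquiv.symm_apply_apply, LinearMap.mulLeft_apply]
  have h1 : ρ a = e (1 ⊗ₜ a) := by
    change ρ a = extendRep ρ (1 ⊗ₜ a)
    rw [extendRep_one_tmul]
  have h2 : (LinearMap.mulLeft F a).baseChange E z = (1 ⊗ₜ a) * z := by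
    induction z using TensorProduct.induction_on with
    | zero => simp
    | tmul x y => simp
    | add x y hx hy => simp [mul_add, hx, hy]
  rw [h1, h2]
  exact (map_mul (extendRep ρ) _ _).symm

/-- A Galois conjugate of the characteristic polynomial has the same power, which is defined over
`F`, hence equals it. This is why splitting is done over the separable closure. -/
theorem exists_map_eq_charpoly [IsGalois F E] (ρ : A →ₐ[F] Matrix ι ι E)
    (hι : Module.finrank F A = Fintype.card ι ^ 2) (a : A) :
    ∃ p : F[X], p.map (algebraMap F E) = (ρ a).charpoly := by
  have h : (ρ a).charpoly ∈ Polynomial.lifts (algebraMap F E) := by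
    rw [Polynomial.lifts_iff_coeff_lifts]
    intro i
    have h1 : (ρ a).charpoly.coeff i ∈ (⊥ : IntermediateField F E) := by
      rw [InfiniteGalois.mem_bot_iff_fixed]
      intro σ
      have hm := (ρ a).charpoly_monic
      have h2 : (ρ a).charpoly.map (σ : E →+* E) = (ρ a).charpoly := by
        refine (hm.map _).pow_left_injective hm (card_ne_zero hι) ?_
        rw [← Polynomial.map_pow, charpoly_pow_card ρ hι, Polynomial.map_map]
        congr 1
        ext x
        simp
      conv_rhs => rw [← h2]
      simp
    exact IntermediateField.mem_bot.1 h1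
  exact (Polynomial.mem_lifts _).1 h

end

theorem exists_isReducedPolynomial (F : Type u) (A : Type v) [Field F] [Ring A] [Algebra F A]
    [Algebra.IsCentral F A] [IsSimpleRing A] [FiniteDimensional F A] :
    ∃ P : A → F[X], IsReducedPolynomial F A P := by
  obtain ⟨n, hn, ⟨φ⟩⟩ := exists_splitting F (SeparableClosure F) A
  have hd : csaDegree F A = n := by rw [csaDegree, hn, Nat.sqrt_eq']
  let ρ : A →ₐ[F] Matrix (Fin n) (Fin n) (SeparableClosure F) :=
    (φ.toAlgHom.restrictScalars F).comp Algebra.TensorProduct.includeRight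
  choose P hP using exists_map_eq_charpoly ρ (by simpa using hn)
  refine ⟨P, SeparableClosure F, inferInstance, inferInstance, ?_⟩
  rw [hd]
  exact ⟨φ, hP⟩

theorem map_reducedPolynomial {F : Type u} {A : Type v} [Field F] [Ring A] [Algebra F A]
    [Algebra.IsCentral F A] [IsSimpleRing A] [FiniteDimensional F A] {E ι : Type*} [Field E]
    [Algebra F E] [Fintype ι] [DecidableEq ι] (ρ : A →ₐ[F] Matrix ι ι E)
    (hι : Module.finrank F A = Fintype.card ι ^ 2) (a : A) :
    (reducedPolynomial F A a).map (algebraMap F E) = (ρ a).charpoly := by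
  have hex := exists_isReducedPolynomial F A
  have hd : csaDegree F A = Fintype.card ι := by rw [csaDegree, hι, Nat.sqrt_eq']
  obtain ⟨E', _, _, φ, hφ⟩ := hex.choose_spec
  replace hφ := hφ a
  have hP : reducedPolynomial F A a = hex.choose a := by rw [reducedPolynomial, dif_pos hex]
  rw [← hP] at hφ
  let ρ' : A →ₐ[F] Matrix (Fin (csaDegree F A)) (Fin (csaDegree F A)) E' :=
    (φ.toAlgHom.restrictScalars F).comp Algebra.TensorProduct.includeRight
  have h1 : (ρ' a).charpoly ^ Fintype.card (Fin (csaDegree F A)) = _ :=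
    charpoly_pow_card ρ' (by rw [hι, Fintype.card_fin, hd]) a
  have h2 : (ρ' a).charpoly = (φ (1 ⊗ₜ[F] a)).charpoly := rfl
  rw [h2, ← hφ, ← Polynomial.map_pow, Fintype.card_fin, hd] at h1
  have h3 := Polynomial.map_injective _ (algebraMap F E').injective h1
  have hm : (reducedPolynomial F A a).Monic := by
    rw [← Polynomial.monic_map_iff (f := algebraMap F E'), hφ]
    exact Matrix.charpoly_monic _
  refine (hm.map _).pow_left_injective (Matrix.charpoly_monic _) (card_ne_zero hι) ?_
  rw [charpoly_pow_card ρ hι, ← Polynomial.map_pow, h3]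

end CentralSimple

/-! ### The second coefficient of the reversed characteristic polynomial -/

namespace Matrix

section CommRing

variable {R ι : Type*} [CommRing R] [Fintype ι] [DecidableEq ι]

theorem dvd_det_sub_det {d : R} {M N : Matrix ι ι R} (h : ∀ i j, d ∣ M i j - N i j) :
    d ∣ M.det - N.det := by
  have h1 : (Ideal.Quotient.mk (Ideal.span {d})).mapMatrix M =
      (Ideal.Quotient.mk (Ideal.span {d})).mapMatrix N := by
    ext i j
    exact (Ideal.Quotient.mk_eq_mk_iff_sub_mem _ _).2 (Ideal.mem_span_singleton.2 (h i j))
  have h2 := congrArg Matrix.det h1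
  rw [← RingHom.map_det, ← RingHom.map_det, Ideal.Quotient.mk_eq_mk_iff_sub_mem,
    Ideal.mem_span_singleton] at h2
  exact h2

theorem charpolyRev_comp (M : Matrix ι ι R) (q : R[X]) :
    M.charpolyRev.comp q = (1 - q • M.map Polynomial.C).det := by
  rw [charpolyRev, ← Polynomial.coe_compRingHom_apply, RingHom.map_det]
  congr 1
  ext i j : 2
  by_cases h : i = j <;> simp [h, mul_comm q]

theorem coeff_zero_charpolyRev (M : Matrix ι ι R) : M.charpolyRev.coeff 0 = 1 := by
  rw [Polynomial.coeff_zero_eq_eval_zero, eval_charpolyRev]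

theorem charpolyRev_zero : (0 : Matrix ι ι R).charpolyRev = 1 := by
  simp [charpolyRev]

/-- Take determinants in `(1 - XM)(1 - XN) ≡ (1 - X(M + N))(1 + X²MN)` mod `X³` and compare
coefficients of `X²`. -/
theorem coeff_two_charpolyRev_add (M N : Matrix ι ι R) :
    (M + N).charpolyRev.coeff 2 = M.charpolyRev.coeff 2 + N.charpolyRev.coeff 2 +
      M.trace * N.trace - (M * N).trace := by
  have key : (Polynomial.X : R[X]) ^ 3 ∣ M.charpolyRev * N.charpolyRev -
      (M + N).charpolyRev * (-(M * N)).charpolyRev.comp (Polynomial.X ^ 2) := by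
    rw [charpolyRev_comp, charpolyRev, charpolyRev, charpolyRev, ← det_mul, ← det_mul]
    refine dvd_det_sub_det fun i j => ?_
    have : (1 - (Polynomial.X : R[X]) • M.map Polynomial.C) *
          (1 - (Polynomial.X : R[X]) • N.map Polynomial.C) -
        (1 - (Polynomial.X : R[X]) • (M + N).map Polynomial.C) *
          (1 - (Polynomial.X ^ 2 : R[X]) • (-(M * N)).map Polynomial.C) =
        (Polynomial.X ^ 3 : R[X]) • ((M + N) * (M * N)).map Polynomial.C := by
      have h1 : ∀ K : Matrix ι ι R, K.map Polynomial.C = Polynomial.C.mapMatrix K := fun _ => rfl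
      simp only [h1, map_add, map_mul, map_neg, sub_mul, mul_sub, one_mul, mul_one, smul_mul_assoc,
        mul_smul_comm, smul_add, smul_neg, add_mul, mul_neg]
      module
    rw [← sub_apply, this]
    exact ⟨_, rfl⟩
  have h2 := Polynomial.X_pow_dvd_iff.1 key 2 (by norm_num)
  rw [← Polynomial.expand_eq_comp_X_pow] at h2
  simp only [Polynomial.coeff_sub, Polynomial.coeff_mul, Finset.Nat.antidiagonal_succ,
    Finset.Nat.antidiagonal_zero, Finset.map_singleton, Finset.sum_cons, Finset.map_cons,
    Finset.sum_singleton, Function.Embedding.prodMap, Function.Embedding.coeFn_mk, Prod.map,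
    Function.Embedding.refl_apply, Polynomial.coeff_expand (Nat.zero_lt_two)] at h2
  norm_num [coeff_zero_charpolyRev] at h2
  linear_combination -h2

theorem coeff_two_charpolyRev_one [CharP R 2] :
    (1 : Matrix ι ι R).charpolyRev.coeff 2 = ((Fintype.card ι).choose 2 : ℕ) := by
  have : (1 : Matrix ι ι R).charpolyRev = (1 + Polynomial.X) ^ Fintype.card ι := by
    rw [charpolyRev, ← CharTwo.sub_eq_add, ← mul_one ((1 - Polynomial.X) ^ _),
      ← det_one (n := ι), ← det_smul]
    congr 1
    ext i j : 2
    by_cases h : i = j <;> simp [h]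
  rw [this, Polynomial.coeff_one_add_X_pow]

end CommRing

section Field

variable {E ι κ : Type*} [Field E] [Fintype ι] [DecidableEq ι] [Fintype κ] [DecidableEq κ]

theorem charpolyRev_fromBlocks_zero₂₁ (a : Matrix ι ι E) (b : Matrix ι κ E) (d : Matrix κ κ E) :
    (fromBlocks a b 0 d).charpolyRev = a.charpolyRev * d.charpolyRev := by
  rw [← reverse_charpoly, charpoly_fromBlocks_zero₂₁, Polynomial.reverse_mul_of_domain,
    reverse_charpoly, reverse_charpoly]

theorem charpolyRev_fromBlocks_zero₁₂ (a : Matrix ι ι E) (c : Matrix κ ι E) (d : Matrix κ κ E) :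
    (fromBlocks a 0 c d).charpolyRev = a.charpolyRev * d.charpolyRev := by
  rw [← reverse_charpoly, charpoly_fromBlocks_zero₁₂, Polynomial.reverse_mul_of_domain,
    reverse_charpoly, reverse_charpoly]

/-- Split off the lower-left block, which is nilpotent, and apply the addition formula; the cross
term has trace `tr(bc)`. -/
theorem coeff_two_charpolyRev_fromBlocks (a : Matrix ι ι E) (b : Matrix ι κ E)
    (c : Matrix κ ι E) (d : Matrix κ κ E) :
    (fromBlocks a b c d).charpolyRev.coeff 2 = a.charpolyRev.coeff 2 + d.charpolyRev.coeff 2 +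
      a.trace * d.trace - (b * c).trace := by
  have h : fromBlocks a b c d = fromBlocks a b 0 d + fromBlocks 0 0 c 0 := by
    simp [fromBlocks_add]
  have ht : ∀ (p : Matrix ι ι E) (q : Matrix ι κ E) (r : Matrix κ ι E) (s : Matrix κ κ E),
      (fromBlocks p q r s).trace = p.trace + s.trace := by
    intro p q r s
    simp [trace, Fintype.sum_sum_type]
  rw [h, coeff_two_charpolyRev_add, charpolyRev_fromBlocks_zero₂₁, charpolyRev_fromBlocks_zero₁₂,
    fromBlocks_multiply, ht, ht, ht, charpolyRev_zero,
    charpolyRev_zero]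
  simp only [Polynomial.coeff_mul, Finset.Nat.antidiagonal_succ,
    Finset.Nat.antidiagonal_zero, Finset.map_singleton, Finset.sum_cons, Finset.map_cons,
    Finset.sum_singleton, Function.Embedding.prodMap, Function.Embedding.coeFn_mk, Prod.map,
    Function.Embedding.refl_apply]
  norm_num [coeff_zero_charpolyRev, Polynomial.coeff_one]
  ring

theorem coeff_charpolyRev {i : ℕ} (hi : i ≤ Fintype.card ι) (M : Matrix ι ι E) :
    M.charpolyRev.coeff i = M.charpoly.coeff (Fintype.card ι - i) := by
  rw [← reverse_charpoly, Polynomial.coeff_reverse, charpoly_natDegree_eq_dim,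
    Polynomial.revAt_le hi]

theorem coeff_charpolyRev_of_card_lt {i : ℕ} (hi : Fintype.card ι < i) (M : Matrix ι ι E) :
    M.charpolyRev.coeff i = 0 := by
  refine Polynomial.coeff_eq_zero_of_natDegree_lt (lt_of_le_of_lt ?_ hi)
  rw [← reverse_charpoly, ← charpoly_natDegree_eq_dim M]
  exact Polynomial.reverse_natDegree_le _

end Field

end Matrix

/-! ### Hyperbolic coordinates -/

theorem binaryForm_apply {F : Type*} [Field F] (a b : F) (x : Fin 2 → F) :
    binaryForm a b x = a * (x 0 * x 0) + x 0 * x 1 + b * (x 1 * x 1) := by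
  simp [binaryForm]

theorem hyperbolicForm_apply {F : Type*} [Field F] (m : ℕ) (x : Fin m → Fin 2 → F) :
    hyperbolicForm F m x = ∑ k, x k 0 * x k 1 := by
  simp [hyperbolicForm, hyperbolicPlane, binaryForm_apply]

/-- The given linear forms have no common zero and their number is the dimension, so they are
coordinates. -/
theorem equivalent_binaryForm_prod_hyperbolicForm {F : Type*} [Field F] {V : Type*}
    [AddCommGroup V] [Module F V] [FiniteDimensional F V] (T : QuadraticForm F V) (c : F)
    (α β : V →ₗ[F] F) {κ : Type*} [Fintype κ] (f g : κ → V →ₗ[F] F)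
    (hT : ∀ v, T v = α v * α v + α v * β v + c * (β v * β v) + ∑ k, f k v * g k v)
    (hinj : ∀ v, α v = 0 → β v = 0 → (∀ k, f k v = 0) → (∀ k, g k v = 0) → v = 0)
    (hdim : Module.finrank F V = 2 + Fintype.card κ * 2) :
    QuadraticMap.Equivalent T ((binaryForm 1 c).prod (hyperbolicForm F (Fintype.card κ))) := by
  let k := (Fintype.equivFin κ).symm
  let Φ : V →ₗ[F] (Fin 2 → F) × (Fin (Fintype.card κ) → Fin 2 → F) :=
    (LinearMap.pi ![α, β]).prod (LinearMap.pi fun i => LinearMap.pi ![f (k i), g (k i)])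
  have hΦ : Function.Injective Φ := by
    rw [← LinearMap.ker_eq_bot, LinearMap.ker_eq_bot']
    intro v hv
    have h1 := congrArg Prod.fst hv
    have h2 := fun i => congrFun (congrArg Prod.snd hv) (k.symm i)
    refine hinj v (congrFun h1 0) (congrFun h1 1) (fun i => ?_) (fun i => ?_)
    · simpa [Φ] using congrFun (h2 i) 0
    · simpa [Φ] using congrFun (h2 i) 1
  refine ⟨⟨LinearEquiv.ofInjectiveOfFinrankEq Φ hΦ ?_, fun v => ?_⟩⟩
  · rw [hdim]
    simp [Module.finrank_pi_fintype]
  · change ((binaryForm 1 c).prod (hyperbolicForm F (Fintype.card κ))) (Φ v) = T v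
    rw [hT, QuadraticMap.prod_apply, binaryForm_apply, hyperbolicForm_apply,
      ← k.sum_comp fun i => f i v * g i v]
    simp [Φ]

theorem binaryForm_one_zero_equivalent (F : Type*) [Field F] :
    QuadraticMap.Equivalent (binaryForm (1 : F) 0) (hyperbolicPlane F) := by
  let e : (Fin 2 → F) ≃ₗ[F] (Fin 2 → F) :=
    { toFun := fun x => ![x 0, x 0 + x 1]
      invFun := fun x => ![x 0, x 1 - x 0]
      map_add' := fun x y => by
        ext i
        fin_cases i <;> simp [add_add_add_comm]
      map_smul' := fun r x => by
        ext i
        fin_cases i <;> simp [mul_add]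
      left_inv := fun x => by
        ext i
        fin_cases i <;> simp
      right_inv := fun x => by
        ext i
        fin_cases i <;> simp }
  refine ⟨⟨e, fun x => ?_⟩⟩
  -- `x² + xy = x(x + y)`.
  change hyperbolicPlane F ![x 0, x 0 + x 1] = _
  simp [hyperbolicPlane, binaryForm_apply]
  ring

theorem wittEquivalent_of_equivalent_prod {F : Type u} [Field F] {V : Type w} {W : Type w'}
    [AddCommGroup V] [Module F V] [AddCommGroup W] [Module F W] {T : QuadraticForm F V}
    {Q : QuadraticForm F W} {m : ℕ}
    (h : QuadraticMap.Equivalent T (Q.prod (hyperbolicForm F m))) : WittEquivalent T Q := by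
  refine ⟨0, m, QuadraticMap.Equivalent.trans ⟨⟨LinearEquiv.prodUnique, fun v => ?_⟩⟩ h⟩
  simp [hyperbolicForm_apply]

/-! ### The trace form of two by two matrices -/

theorem exists_basis_eq_one (F B : Type*) [Field F] [Ring B] [Nontrivial B] [Algebra F B]
    [FiniteDimensional F B] :
    ∃ (ι : Set B) (_ : Fintype ι) (b : Module.Basis ι F B) (i : ι), b i = 1 := by
  have hli : LinearIndepOn F id ({1} : Set B) := by simp
  let b := Module.Basis.extend hli
  exact ⟨_, FiniteDimensional.fintypeBasisIndex b, b, ⟨1, hli.subset_extend _ rfl⟩,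
    Module.Basis.extend_apply_self hli _⟩

/-- The computation at the heart of the proof, using only the polar identity for `Q` and the
nondegeneracy of `t`. A possibly non-symmetric bilinear `M` with `M x x = Q x` serves to expand `Q`
in characteristic 2. -/
theorem exists_equivalent_of_blocks {F B V : Type*} [Field F] [CharP F 2] [Ring B] [Nontrivial B]
    [Algebra F B] [FiniteDimensional F B] [AddCommGroup V] [Module F V] (t : B →ₗ[F] F)
    (Q : QuadraticForm F B) (hnd : ∀ x, (∀ y, t (x * y) = 0) → x = 0)
    (hQ : ∀ x y, Q (x + y) = Q x + Q y + t x * t y - t (x * y))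
    (T : QuadraticForm F V) (e : V ≃ₗ[F] Matrix (Fin 2) (Fin 2) B)
    (hT : ∀ v, T v = Q (e v 0 0) + Q (e v 1 1) + t (e v 0 0) * t (e v 1 1) -
      t (e v 0 1 * e v 1 0)) :
    ∃ m, QuadraticMap.Equivalent T ((binaryForm 1 (Q 1)).prod (hyperbolicForm F m)) := by
  classical
  obtain ⟨M, rfl⟩ := LinearMap.BilinMap.toQuadraticMap_surjective Q
  simp only [LinearMap.BilinMap.toQuadraticMap_apply] at hQ hT ⊢
  obtain ⟨ι, _, b, i₀, hi₀⟩ := exists_basis_eq_one F B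
  have hfd : FiniteDimensional F V := e.symm.finiteDimensional
  let entry (i j : Fin 2) : V →ₗ[F] B := Matrix.entryLinearMap F B i j ∘ₗ e.toLinearMap
  have hentry : ∀ i j v, entry i j v = e v i j := fun _ _ _ => rfl
  let s : V →ₗ[F] B := entry 0 0 + entry 1 1
  -- The total cofactor of the `i`-th coordinate of `s` in `t(xs) + M(s, s)`, where `x` is the
  -- upper-left entry; only the terms in the coordinate at 1 are left over.
  let f₁ (i : {i // i ≠ i₀}) : V →ₗ[F] F :=
    t ∘ₗ LinearMap.mulRight F (b i) ∘ₗ entry 0 0 + M (b i) ∘ₗ s + M 1 (b i) • (b.coord i₀ ∘ₗ s)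
  let f₂ (j : ι) : V →ₗ[F] F :=
    t ∘ₗ LinearMap.mulRight F (b j) ∘ₗ entry 0 1
  have hsum : ∀ x y : B, t (x * y) = ∑ i, t (x * b i) * b.repr y i := by
    intro x y
    conv_lhs => rw [← b.sum_repr y]
    simp only [Finset.mul_sum, mul_smul_comm, map_sum, map_smul, smul_eq_mul, mul_comm]
  have hsplit : ∀ φ : ι → F,
      ∑ i, φ i = φ i₀ + ∑ i : {i // i ≠ i₀}, φ i := fun φ =>
    Fintype.sum_eq_add_sum_subtype_ne φ i₀
  have hM : ∀ φ : B →ₗ[F] F, ∀ y, φ y = b.repr y i₀ * φ 1 +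
      ∑ i : {i // i ≠ i₀}, b.repr y i * φ (b i) := by
    intro φ y
    rw [← hi₀, ← hsplit fun i => b.repr y i * φ (b i)]
    conv_lhs => rw [← b.sum_repr y]
    simp only [map_sum, map_smul, smul_eq_mul]
  refine ⟨_, equivalent_binaryForm_prod_hyperbolicForm T (M 1 1) (t ∘ₗ entry 0 0)
    (b.coord i₀ ∘ₗ s) (Sum.elim f₁ f₂)
    (Sum.elim (fun i => b.coord i ∘ₗ s) (fun j => b.coord j ∘ₗ entry 1 0)) ?_ ?_ ?_⟩
  · intro v
    have h1 : T v = M (s v) (s v) + t (entry 0 0 v * s v) + t (entry 0 0 v) * t (entry 0 0 v) +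
        t (entry 0 1 v * entry 1 0 v) := by
      have h2 := hQ (entry 0 0 v) (entry 1 1 v)
      -- Since `x + x = 0`, this yields `t(x²) = t(x)²`, the source of the term `α²`.
      have h3 := hQ (entry 0 0 v) (entry 0 0 v)
      have h4 : entry 0 0 v + entry 0 0 v = (2 : F) • entry 0 0 v := (two_smul F _).symm
      have h5 : (2 : F) = 0 := CharTwo.two_eq_zero
      rw [h4, h5] at h3
      simp only [zero_smul, map_zero] at h3
      rw [hT, ← hentry, ← hentry, ← hentry, ← hentry]
      simp only [s, LinearMap.add_apply, mul_add, map_add] at h2 ⊢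
      linear_combination -h2 - h3 - (t (entry 0 1 v * entry 1 0 v) +
        t (entry 0 0 v) * t (entry 0 0 v) + M (entry 0 0 v) (entry 0 0 v)) * h5
    have h6 : M (s v) (s v) = M 1 1 * (b.repr (s v) i₀ * b.repr (s v) i₀) +
        ∑ i : {i // i ≠ i₀}, (M (b i) (s v) + M 1 (b i) * b.repr (s v) i₀) * b.repr (s v) i := by
      have h7 := hM (M.flip (s v)) (s v)
      simp only [LinearMap.flip_apply] at h7
      rw [h7, hM (M 1) (s v), mul_add, Finset.mul_sum, add_assoc, ← Finset.sum_add_distrib]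
      congr 1
      · ring
      · exact Finset.sum_congr rfl fun i _ => by ring
    rw [h1, h6, hsum, hsum, hsplit, hi₀, mul_one, Fintype.sum_sum_type]
    simp only [Sum.elim_inl, Sum.elim_inr, f₁, f₂, LinearMap.add_apply, LinearMap.comp_apply,
      LinearMap.smul_apply, LinearMap.mulRight_apply, Module.Basis.coord_apply, smul_eq_mul,
      add_mul, Finset.sum_add_distrib]
    ring
  · intro v hα hβ hf hg
    have hs : s v = 0 := by
      refine b.ext_elem fun i => ?_
      by_cases hi : i = i₀
      · subst hi
        simpa using hβ
      · simpa using hg (Sum.inl ⟨i, hi⟩)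
    have h10 : entry 1 0 v = 0 := b.ext_elem fun i => by simpa using hg (Sum.inr i)
    have h01 : entry 0 1 v = 0 := hnd _ fun y => by
      rw [hsum]
      refine Finset.sum_eq_zero fun i _ => ?_
      rw [show t (entry 0 1 v * b i) = 0 from hf (Sum.inr i), zero_mul]
    -- `α` tests against the basis vector 1; once `s = 0`, `f₁` tests against the others.
    have h00 : entry 0 0 v = 0 := hnd _ fun y => by
      rw [hsum]
      refine Finset.sum_eq_zero fun i _ => ?_
      by_cases hi : i = i₀
      · rw [hi, hi₀, mul_one, show t (entry 0 0 v) = 0 from hα, zero_mul]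
      · have := hf (Sum.inl ⟨i, hi⟩)
        simp only [Sum.elim_inl, f₁, LinearMap.add_apply, LinearMap.comp_apply, hs, map_zero,
          LinearMap.smul_apply, smul_zero, add_zero, LinearMap.mulRight_apply] at this
        rw [this, zero_mul]
    have h11 : entry 1 1 v = 0 := by
      have : s v = entry 0 0 v + entry 1 1 v := rfl
      rw [hs, h00, zero_add] at this
      exact this.symm
    apply e.injective
    rw [map_zero]
    ext i j
    fin_cases i <;> fin_cases j
    exacts [h00, h01, h10, h11]
  · have hc := Module.finrank_eq_card_basis b
    -- With `d = dim B` the count is `4d = 2 + 2((d - 1) + d)`; positivity keeps the truncated `d -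
    -- 1` honest.
    have hpos : 0 < Module.finrank F B := Module.finrank_pos
    rw [e.finrank_eq, Module.finrank_matrix, Fintype.card_sum, Fintype.card_subtype_compl, ← hc]
    simp
    omega

/-! ### The trace forms of a central simple algebra -/

namespace CentralSimple

section Split

variable {F : Type u} {A : Type v} [Field F] [Ring A] [Algebra F A]
  [Algebra.IsCentral F A] [IsSimpleRing A] [FiniteDimensional F A]
  {E ι : Type*} [Field E] [Algebra F E] [Fintype ι] [DecidableEq ι]

/-- Reversed characteristic polynomials make this uniform in `i`: both sides vanish beyond the
degree. Thus degree one needs no separate treatment, as happens for `B = F`. -/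
theorem algebraMap_reducedCoeff (ρ : A →ₐ[F] Matrix ι ι E)
    (hι : Module.finrank F A = Fintype.card ι ^ 2) (i : ℕ) (a : A) :
    algebraMap F E (reducedCoeff F A i a) = (-1) ^ i * (ρ a).charpolyRev.coeff i := by
  have hd : csaDegree F A = Fintype.card ι := by rw [csaDegree, hι, Nat.sqrt_eq']
  rw [reducedCoeff, hd]
  split_ifs with h
  · rw [Matrix.coeff_charpolyRev h, ← map_reducedPolynomial ρ hι, Polynomial.coeff_map, map_mul,
      map_pow, map_neg, map_one]
  · rw [Matrix.coeff_charpolyRev_of_card_lt (not_le.1 h), map_zero, mul_zero]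

theorem algebraMap_secondTraceForm (ρ : A →ₐ[F] Matrix ι ι E)
    (hι : Module.finrank F A = Fintype.card ι ^ 2) (a : A) :
    algebraMap F E (secondTraceForm F A a) = (ρ a).charpolyRev.coeff 2 := by
  have h := algebraMap_reducedCoeff ρ hι 2 a
  rwa [neg_one_sq, one_mul] at h

theorem exists_reducedTrace (ρ : A →ₐ[F] Matrix ι ι E)
    (hι : Module.finrank F A = Fintype.card ι ^ 2) :
    ∃ t : A →ₗ[F] F, ∀ a, algebraMap F E (t a) = (ρ a).trace := by
  have h : ∀ a, algebraMap F E (reducedCoeff F A 1 a) = (ρ a).trace := fun a => by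
    rw [algebraMap_reducedCoeff ρ hι, Matrix.coeff_charpolyRev_eq_neg_trace]
    ring
  refine ⟨⟨⟨reducedCoeff F A 1, fun a b => ?_⟩, fun c a => ?_⟩, h⟩
  · apply (algebraMap F E).injective
    rw [map_add, h, h, h, map_add, Matrix.trace_add]
  · apply (algebraMap F E).injective
    change algebraMap F E (reducedCoeff F A 1 (c • a)) = algebraMap F E (c * reducedCoeff F A 1 a)
    rw [map_mul, h, h, map_smul, Matrix.trace_smul, Algebra.smul_def]

/-- The image of `ρ` spans the matrix algebra over `E`, where the trace form is nondegenerate. -/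
theorem eq_zero_of_trace_mul_eq_zero (ρ : A →ₐ[F] Matrix ι ι E)
    (hι : Module.finrank F A = Fintype.card ι ^ 2) {x : A}
    (hx : ∀ y, (ρ (x * y)).trace = 0) : x = 0 := by
  have : Nonempty ι := Fintype.card_pos_iff.1 (Nat.pos_of_ne_zero (card_ne_zero hι))
  have h : ∀ z, (ρ x * extendRep ρ z).trace = 0 := by
    intro z
    induction z using TensorProduct.induction_on with
    | zero => simp
    | add y z hy hz => rw [map_add, mul_add, Matrix.trace_add, hy, hz, add_zero]
    | tmul e y =>
      have h1 : e ⊗ₜ[F] y = e • ((1 : E) ⊗ₜ[F] y) := by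
        rw [TensorProduct.smul_tmul', smul_eq_mul, mul_one]
      rw [h1, map_smul, extendRep_one_tmul, mul_smul_comm, Matrix.trace_smul, ← map_mul, hx,
        smul_zero]
  have h0 : ρ x = 0 := by
    rw [Matrix.ext_iff_trace_mul_right]
    intro N
    obtain ⟨z, rfl⟩ := (extendRep_bijective ρ hι).2 N
    rw [h, zero_mul, Matrix.trace_zero]
  exact (map_eq_zero_iff ρ ρ.toRingHom.injective).1 h0

theorem secondTraceForm_add (ρ : A →ₐ[F] Matrix ι ι E)
    (hι : Module.finrank F A = Fintype.card ι ^ 2) {t : A →ₗ[F] F}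
    (ht : ∀ a, algebraMap F E (t a) = (ρ a).trace) (x y : A) :
    secondTraceForm F A (x + y) =
      secondTraceForm F A x + secondTraceForm F A y + t x * t y - t (x * y) := by
  apply (algebraMap F E).injective
  simp only [map_add, map_sub, map_mul, ht, algebraMap_secondTraceForm ρ hι]
  exact Matrix.coeff_two_charpolyRev_add _ _

/-- The value is `n.choose 2` reduced mod 2, where `n` is the degree. -/
theorem secondTraceForm_one [CharP F 2] (ρ : A →ₐ[F] Matrix ι ι E)
    (hι : Module.finrank F A = Fintype.card ι ^ 2) :
    secondTraceForm F A 1 = 0 ∨ secondTraceForm F A 1 = 1 := by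
  have : CharP E 2 := charP_of_injective_algebraMap (algebraMap F E).injective 2
  have h : secondTraceForm F A 1 = ((Fintype.card ι).choose 2 : ℕ) := by
    apply (algebraMap F E).injective
    rw [algebraMap_secondTraceForm ρ hι, map_one, Matrix.coeff_two_charpolyRev_one, map_natCast]
  rw [h]
  rcases Nat.even_or_odd ((Fintype.card ι).choose 2) with ⟨k, hk⟩ | ⟨k, hk⟩
  · left
    rw [hk, Nat.cast_add, CharTwo.add_self_eq_zero]
  · right
    rw [hk, Nat.cast_add, Nat.cast_mul, Nat.cast_ofNat, CharTwo.two_eq_zero, zero_mul, zero_add,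
      Nat.cast_one]

/-- The representation of `M_2(B)` by block matrices. -/
def blockRep {B : Type*} [Ring B] [Algebra F B] (ρ : B →ₐ[F] Matrix ι ι E) :
    Matrix (Fin 2) (Fin 2) B →ₐ[F] Matrix (ι ⊕ ι) (ι ⊕ ι) E :=
  (Matrix.reindexAlgEquiv F E
    ((Equiv.prodCongr finTwoEquiv (Equiv.refl ι)).trans (Equiv.boolProdEquivSum ι))).toAlgHom.comp
    ((Matrix.compAlgEquiv (Fin 2) ι E F).toAlgHom.comp ρ.mapMatrix)

theorem blockRep_apply {B : Type*} [Ring B] [Algebra F B] (ρ : B →ₐ[F] Matrix ι ι E)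
    (X : Matrix (Fin 2) (Fin 2) B) :
    blockRep ρ X = Matrix.fromBlocks (ρ (X 0 0)) (ρ (X 0 1)) (ρ (X 1 0)) (ρ (X 1 1)) := by
  ext i j
  rcases i with i | i <;> rcases j with j | j <;> rfl

end Split

theorem wittEquivalent_of_algEquiv_matrix_two {F : Type u} [Field F] [CharP F 2] {A : Type v}
    [Ring A] [Algebra F A] [Algebra.IsCentral F A] [IsSimpleRing A] [FiniteDimensional F A]
    {B : Type v} [Ring B] [Algebra F B] [Algebra.IsCentral F B] [IsSimpleRing B]
    [FiniteDimensional F B] (e : A ≃ₐ[F] Matrix (Fin 2) (Fin 2) B) :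
    WittEquivalent (secondTraceForm F A) (binaryForm (1 : F) (1 : F)) ∨
      WittEquivalent (secondTraceForm F A) (hyperbolicPlane F) := by
  obtain ⟨n, hn, ⟨φ⟩⟩ := exists_splitting F (SeparableClosure F) B
  let ρ : B →ₐ[F] Matrix (Fin n) (Fin n) (SeparableClosure F) :=
    (φ.toAlgHom.restrictScalars F).comp Algebra.TensorProduct.includeRight
  have hρ : Module.finrank F B = Fintype.card (Fin n) ^ 2 := by simpa using hn
  let σ := (blockRep ρ).comp e.toAlgHom
  have hσ : Module.finrank F A = Fintype.card (Fin n ⊕ Fin n) ^ 2 := by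
    rw [e.toLinearEquiv.finrank_eq, Module.finrank_matrix, hn]
    simp
    ring
  obtain ⟨t, ht⟩ := exists_reducedTrace ρ hρ
  obtain ⟨m, hm⟩ := exists_equivalent_of_blocks t (secondTraceForm F B)
    (fun x hx => eq_zero_of_trace_mul_eq_zero ρ hρ fun y => by rw [← ht, hx, map_zero])
    (secondTraceForm_add ρ hρ ht) (secondTraceForm F A) e.toLinearEquiv fun a => by
      apply (algebraMap F (SeparableClosure F)).injective
      have hb : σ a = Matrix.fromBlocks (ρ (e a 0 0)) (ρ (e a 0 1)) (ρ (e a 1 0))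
        (ρ (e a 1 1)) := blockRep_apply ρ (e a)
      simp only [map_add, map_sub, map_mul, ht, algebraMap_secondTraceForm ρ hρ]
      rw [algebraMap_secondTraceForm σ hσ, hb, Matrix.coeff_two_charpolyRev_fromBlocks]
      rfl
  rcases secondTraceForm_one ρ hρ with h | h
  · right
    rw [h] at hm
    obtain ⟨f⟩ := binaryForm_one_zero_equivalent F
    exact wittEquivalent_of_equivalent_prod
      (hm.trans ⟨f.prod (QuadraticMap.IsometryEquiv.refl _)⟩)
  · left
    rw [h] at hm
    exact wittEquivalent_of_equivalent_prod hm

end CentralSimple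

theorem corollary3 {F : Type u} [Field F] [CharP F 2]
    {A : Type v} [Ring A] [Algebra F A]
    [Algebra.IsCentral F A] [IsSimpleRing A] [FiniteDimensional F A]
    (hdeg : Even (csaDegree F A))
    (h11 : ¬ WittEquivalent (secondTraceForm F A) (binaryForm (1 : F) (1 : F)))
    (hH : ¬ WittEquivalent (secondTraceForm F A) (hyperbolicPlane F)) :
    ∃ (k : ℕ) (D : Type v) (_ : DivisionRing D) (_ : Algebra F D),
      Odd k ∧ Nonempty (A ≃ₐ[F] Matrix (Fin k) (Fin k) D) := by
  have := IsArtinianRing.of_finite F A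
  obtain ⟨k, hk, D, _, _, _, ⟨e⟩⟩ := IsSimpleRing.exists_algEquiv_matrix_divisionRing_finite F A
  refine ⟨k, D, inferInstance, inferInstance, ?_, ⟨e⟩⟩
  by_contra hodd
  obtain ⟨l, hl⟩ := (Nat.not_odd_iff_even.1 hodd).two_dvd
  have hl0 : l ≠ 0 := by
    rintro rfl
    exact hk.out hl
  have : Nonempty (Fin l) := ⟨⟨0, Nat.pos_of_ne_zero hl0⟩⟩
  have : Nonempty (Fin k) := ⟨⟨0, Nat.pos_of_ne_zero hk.out⟩⟩
  have := Algebra.IsCentral.of_algEquiv F _ _ e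
  have hD : Algebra.IsCentral F D := CentralSimple.isCentral_of_matrix F D (ι := Fin k)
  -- With `k = 2l`, cut the matrices into four blocks of size `l`.
  let e' : A ≃ₐ[F] Matrix (Fin 2) (Fin 2) (Matrix (Fin l) (Fin l) D) :=
    e.trans ((Matrix.reindexAlgEquiv F D
      ((finCongr hl).trans finProdFinEquiv.symm)).trans
      (Matrix.compAlgEquiv (Fin 2) (Fin l) D F).symm)
  exact (CentralSimple.wittEquivalent_of_algEquiv_matrix_two e').elim h11 hH
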